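/- **Languages.** Base types are generated by $b ::= 0 \mid 1 \mid b+b \mid b\times b$ and denote finite-dimensional Hilbert spaces: $[\![0]\!]=0$, $[\![1]\!]=\mathbb{C}$, $[\![b+b']\!]=[\![b]\!]\oplus[\![b']\!]$, $[\![b\times b']\!]=[\![b]\!]\otimes[\![b']\!]$; thus $1+1$ denotes a qubit and its $n$-fold product an $n$-qubit system. The combinators $u : b_1\leftrightarrow b_2$ of $\mathcal{U}\Pi$ are generated, under sequential composition, $+$ and $\times$, by the identities; the symmetries $b_1+b_2\leftrightarrow b_2+b_1$ and $b_1\times b_2\leftrightarrow b_2\times b_1$; the unitors $b+0\leftrightarrow b$ and $b\times 1\leftrightarrow b$; the associators of $+$ and $\times$; the distributors $b_1\times(b_2+b_3)\leftrightarrow(b_1\times b_2)+(b_1\times b_3)$ and $b\times 0\leftrightarrow 0$; the inverses of all of these; $\mathit{phase}_\varphi:1\leftrightarrow1$ for every $\varphi\in\mathbb{C}$ with $|\varphi|=1$; and $\mathit{hadamard}:1+1\leftrightarrow1+1$. They denote unitaries $[\![u]\!]:[\![b_1]\!]\to[\![b_2]\!]$: the structural combinators denote the canonical isomorphisms, $\mathit{phase}_\varphi$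 multiplication by $\varphi$, $\mathit{hadamard}$ the matrix $\frac1{\sqrt2}\begin{pmatrix}1&1\\1&-1\end{pmatrix}$, and sequential composition, $+$ and $\times$ denote composition, $\oplus$ and $\otimes$. A combinator $v : b_1\rightarrowtail b_2$ of $\mathcal{U}\Pi_a$ (allocation) is $\mathit{lift}\,u$ for a $\mathcal{U}\Pi$ combinator $u:b_1+b_3\leftrightarrow b_2$ with some heap type $b_3$; it denotes the isometry $[\![v]\!]=[\![u]\!]\circ\mathrm{inl}$. Inhabited types are those generated by: $1$ is inhabited; $b\times b'$ is inhabited if both $b$ and $b'$ are; $b+b'$ is inhabited if $b$ or $b'$ is. A combinator $c : b_1\rightsquigarrow b_2$ of $\mathcal{U}\Pi^\chi_a$ (allocation and hiding) is $\mathit{lift}\,v$ for a $\mathcal{U}\Pi_a$ combinator $v:b_1\rightarrowtail b_2\times b_3$ with some inhabited garbage type $b_3$; it denotes the completely positive trace-preserving (CPTP) map $[\![c]\!](\rho)=\mathrm{tr}_{[\![b_3]\!]}\big([\![v]\!]\,\rho\,[\![v]\!]^\dagger\big)$. **Theorem.** $\mathcal{U}\Pi^\chi_a$ is approximately universal for quantum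 channels: for all base types $b_1,b_2$ (in particular for qubit systems), every quantum channel (CPTP map) $\Lambda$ from operators on $[\![b_1]\!]$ to operators on $[\![b_2]\!]$ and every $\delta>0$ there is a $\mathcal{U}\Pi^\chi_a$ combinator $c:b_1\rightsquigarrow b_2$ such that $\|\Lambda-[\![c]\!]\|<\delta$, where $\|\cdot\|$ may be taken to be the operator norm of linear maps induced by the operator (spectral) norm on operators, the one induced by the trace norm on operators, or the diamond norm $\|\Phi\|_\diamond=\sup_k\|\Phi\otimes\mathrm{id}_{M_k(\mathbb{C})}\|_{1\to1}$; a single $c$ serves for all three. -/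

import Mathlib

/-! ## Base types and their Hilbert spaces -/

/-- Base types `b ::= 0 | 1 | b + b | b × b`. -/
inductive Ty : Type
  | zero : Ty
  | one : Ty
  | sum : Ty → Ty → Ty
  | prod : Ty → Ty → Ty

namespace Ty

/-- The computational basis of the finite dimensional Hilbert space `⟦b⟧ = ℂ^(Basis b)`, with
`⟦0⟧ = 0`, `⟦1⟧ = ℂ`, `⟦b + b'⟧ = ⟦b⟧ ⊕ ⟦b'⟧` and `⟦b × b'⟧ = ⟦b⟧ ⊗ ⟦b'⟧`. -/
@[reducible] def Basis : Ty → Type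
  | zero => Empty
  | one => Unit
  | sum a b => Basis a ⊕ Basis b
  | prod a b => Basis a × Basis b

instance instFintypeBasis : (b : Ty) → Fintype b.Basis
  | zero => inferInstanceAs (Fintype Empty)
  | one => inferInstanceAs (Fintype Unit)
  | sum a b =>
    letI := instFintypeBasis a
    letI := instFintypeBasis b
    inferInstanceAs (Fintype (Basis a ⊕ Basis b))
  | prod a b =>
    letI := instFintypeBasis a
    letI := instFintypeBasis b
    inferInstanceAs (Fintype (Basis a × Basis b))

instance instDecidableEqBasis : (b : Ty) → DecidableEq b.Basis
  | zero => inferInstanceAs (DecidableEq Empty)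
  | one => inferInstanceAs (DecidableEq Unit)
  | sum a b =>
    letI := instDecidableEqBasis a
    letI := instDecidableEqBasis b
    inferInstanceAs (DecidableEq (Basis a ⊕ Basis b))
  | prod a b =>
    letI := instDecidableEqBasis a
    letI := instDecidableEqBasis b
    inferInstanceAs (DecidableEq (Basis a × Basis b))

/-- The inhabitation judgement on base types. -/
inductive Inhabited : Ty → Prop
  | one : Inhabited Ty.one
  | prod {a b : Ty} : Inhabited a → Inhabited b → Inhabited (Ty.prod a b)
  | sumLeft {a b : Ty} : Inhabited a → Inhabited (Ty.sum a b)
  | sumRight {a b : Ty} : Inhabited b → Inhabited (Ty.sum a b)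

end Ty

/-! ## The reversible language `UΠ` -/

/-- Well-typed combinators `b₁ ↔ b₂` of `UΠ`. -/
inductive UPi : Ty → Ty → Type
  | id {b : Ty} : UPi b b
  | swapSum {a b : Ty} : UPi (.sum a b) (.sum b a)
  | unitSum {b : Ty} : UPi (.sum b .zero) b
  | unitiSum {b : Ty} : UPi b (.sum b .zero)
  | assocSum {a b c : Ty} : UPi (.sum (.sum a b) c) (.sum a (.sum b c))
  | associSum {a b c : Ty} : UPi (.sum a (.sum b c)) (.sum (.sum a b) c)
  | swapProd {a b : Ty} : UPi (.prod a b) (.prod b a)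
  | unitProd {b : Ty} : UPi (.prod b .one) b
  | unitiProd {b : Ty} : UPi b (.prod b .one)
  | assocProd {a b c : Ty} : UPi (.prod (.prod a b) c) (.prod a (.prod b c))
  | associProd {a b c : Ty} : UPi (.prod a (.prod b c)) (.prod (.prod a b) c)
  | distrib {a b c : Ty} : UPi (.prod a (.sum b c)) (.sum (.prod a b) (.prod a c))
  | distribi {a b c : Ty} : UPi (.sum (.prod a b) (.prod a c)) (.prod a (.sum b c))
  | distribo {b : Ty} : UPi (.prod b .zero) .zero
  | distriboi {b : Ty} : UPi .zero (.prod b .zero)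
  /-- Multiplication by a complex number of modulus one. -/
  | phase (φ : Circle) : UPi .one .one
  | hadamard : UPi (.sum .one .one) (.sum .one .one)
  /-- Sequential composition, in diagrammatic order. -/
  | comp {a b c : Ty} : UPi a b → UPi b c → UPi a c
  | sum {a b c d : Ty} : UPi a c → UPi b d → UPi (.sum a b) (.sum c d)
  | prod {a b c d : Ty} : UPi a c → UPi b d → UPi (.prod a b) (.prod c d)

/-- The matrix of the linear map `ℂ^α → ℂ^β` that sends the basis vector `|x⟩` to `|e x⟩`. -/
def basisBij {α β : Type} [DecidableEq β] (e : α ≃ β) : Matrix β α ℂ :=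
  Matrix.of fun y x => if y = e x then 1 else 0

namespace UPi

/-- The semantics of `UΠ` combinators in `Unitary`, as matrices with respect to the computational
bases: the matrix of a combinator `b₁ ↔ b₂` has rows indexed by the basis of `⟦b₂⟧` and columns
indexed by the basis of `⟦b₁⟧`. -/
noncomputable def sem : {a b : Ty} → UPi a b → Matrix b.Basis a.Basis ℂ
  | _, _, .id => 1
  | _, _, .swapSum => basisBij (Equiv.sumComm _ _)
  | _, _, .unitSum => basisBij (Equiv.sumEmpty _ _)
  | _, _, .unitiSum => basisBij (Equiv.sumEmpty _ _).symm
  | _, _, .assocSum => basisBij (Equiv.sumAssoc _ _ _)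
  | _, _, .associSum => basisBij (Equiv.sumAssoc _ _ _).symm
  | _, _, .swapProd => basisBij (Equiv.prodComm _ _)
  | _, _, .unitProd => basisBij (Equiv.prodPUnit _)
  | _, _, .unitiProd => basisBij (Equiv.prodPUnit _).symm
  | _, _, .assocProd => basisBij (Equiv.prodAssoc _ _ _)
  | _, _, .associProd => basisBij (Equiv.prodAssoc _ _ _).symm
  | _, _, .distrib => basisBij (Equiv.prodSumDistrib _ _ _)
  | _, _, .distribi => basisBij (Equiv.prodSumDistrib _ _ _).symm
  | _, _, .distribo => basisBij (Equiv.prodEmpty _)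
  | _, _, .distriboi => basisBij (Equiv.prodEmpty _).symm
  | _, _, .phase φ => Matrix.of fun _ _ => (φ : ℂ)
  | _, _, .hadamard => ((1 / Real.sqrt 2 : ℝ) : ℂ) •
      Matrix.fromBlocks (Matrix.of fun _ _ => 1) (Matrix.of fun _ _ => 1)
        (Matrix.of fun _ _ => 1) (Matrix.of fun _ _ => -1)
  | _, _, .comp u v => sem v * sem u
  | _, _, .sum u v => Matrix.fromBlocks (sem u) 0 0 (sem v)
  | _, _, .prod u v => Matrix.kroneckerMap (fun x y => x * y) (sem u) (sem v)

end UPi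

/-! ## Allocation: the arrow metalanguage `UΠ_a` -/

/-- Well-typed combinators `b₁ ↣ b₂` of `UΠ_a`. The only primitive is `lift u`, for a `UΠ`
combinator `u : b₁ + b₃ ↔ b₂` with a heap of type `b₃`; all other combinators of the language
(`arr`, `>>>`, `***`, `+++`, `alloc`, `clone`, ...) are abbreviations of terms of this form. -/
inductive UPiA : Ty → Ty → Type
  | lift {b₁ b₂ b₃ : Ty} (u : UPi (.sum b₁ b₃) b₂) : UPiA b₁ b₂

namespace UPiA

/-- The semantics of `UΠ_a` combinators in `Isometry`: `⟦lift u⟧` is the first injection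
`⟦b₁⟧ → ⟦b₁⟧ ⊕ ⟦b₃⟧` followed by the unitary `⟦u⟧`. -/
noncomputable def sem : {a b : Ty} → UPiA a b → Matrix b.Basis a.Basis ℂ
  | _, _, .lift u => u.sem.submatrix _root_.id Sum.inl

end UPiA

/-! ## Quantum channels -/

/-- The partial trace over the second tensor factor. -/
def partialTraceRight {β γ : Type} [Fintype γ] :
    Matrix (β × γ) (β × γ) ℂ →ₗ[ℂ] Matrix β β ℂ where
  toFun X := Matrix.of fun i j => ∑ g, X (i, g) (j, g)
  map_add' X Y := by
    ext i j
    exact Finset.sum_add_distrib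
  map_smul' r X := by
    ext i j
    exact (Finset.mul_sum _ _ _).symm

/-- Conjugation `ρ ↦ V ρ V†`. -/
def conjMap {α β : Type} [Fintype α] (V : Matrix β α ℂ) :
    Matrix α α ℂ →ₗ[ℂ] Matrix β β ℂ where
  toFun ρ := V * ρ * V.conjTranspose
  map_add' X Y := by simp [Matrix.mul_add, Matrix.add_mul]
  map_smul' r X := by simp

section Channels

open scoped Matrix.Norms.L2Operator MatrixOrder CStarAlgebra

/-- Quantum channels `ℂ^α → ℂ^β`: completely positive trace-preserving linear maps. The matrix
algebras carry the operator norm and the order given by positive semidefiniteness. -/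
structure QuantumChannel (α β : Type) [Fintype α] [DecidableEq α] [Fintype β] [DecidableEq β]
    extends Matrix α α ℂ →CP Matrix β β ℂ where
  trace_map : ∀ X : Matrix α α ℂ, (toLinearMap X).trace = X.trace

/-- The linear map on matrices underlying a quantum channel. -/
def QuantumChannel.map {α β : Type} [Fintype α] [DecidableEq α] [Fintype β] [DecidableEq β]
    (Λ : QuantumChannel α β) : Matrix α α ℂ →ₗ[ℂ] Matrix β β ℂ :=
  Λ.toLinearMap

/-- The operator norm of a linear map between matrix algebras, where the matrix algebras carry the
operator norm (largest singular value). -/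
noncomputable def spectralOpNorm {α β : Type} [Fintype α] [DecidableEq α] [Fintype β]
    [DecidableEq β] (Φ : Matrix α α ℂ →ₗ[ℂ] Matrix β β ℂ) : ℝ :=
  ‖LinearMap.toContinuousLinearMap Φ‖

end Channels

/-- The trace norm of a matrix: the sum of its singular values. -/
noncomputable def traceNorm {α : Type} [Fintype α] [DecidableEq α] (X : Matrix α α ℂ) : ℝ :=
  (Matrix.toEuclideanLin X).singularValues.sum fun _ s => s

/-- The operator norm of a linear map between matrix algebras, where the matrix algebras carry the
trace norm. -/
noncomputable def traceOpNorm {α β : Type} [Fintype α] [DecidableEq α] [Fintype β]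
    [DecidableEq β] (Φ : Matrix α α ℂ →ₗ[ℂ] Matrix β β ℂ) : ENNReal :=
  ⨆ (X : Matrix α α ℂ) (_ : traceNorm X ≤ 1), ENNReal.ofReal (traceNorm (Φ X))

/-- The linear map `Φ ⊗ id` on matrices over the product with a `k`-dimensional system. -/
def ampliation {α β : Type} (Φ : Matrix α α ℂ →ₗ[ℂ] Matrix β β ℂ) (k : ℕ) :
    Matrix (α × Fin k) (α × Fin k) ℂ →ₗ[ℂ] Matrix (β × Fin k) (β × Fin k) ℂ where
  toFun X := Matrix.of fun i j => Φ (Matrix.of fun s t => X (s, i.2) (t, j.2)) i.1 j.1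
  map_add' X Y := by
    ext i j
    exact congrFun (congrFun (map_add Φ (Matrix.of fun s t => X (s, i.2) (t, j.2))
      (Matrix.of fun s t => Y (s, i.2) (t, j.2))) i.1) j.1
  map_smul' r X := by
    ext i j
    exact congrFun (congrFun (map_smul Φ r (Matrix.of fun s t => X (s, i.2) (t, j.2))) i.1) j.1

/-- The diamond norm (completely bounded trace norm). -/
noncomputable def diamondNorm {α β : Type} [Fintype α] [DecidableEq α] [Fintype β]
    [DecidableEq β] (Φ : Matrix α α ℂ →ₗ[ℂ] Matrix β β ℂ) : ENNReal :=
  ⨆ k : ℕ, traceOpNorm (ampliation Φ k)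

/-! ## Hiding: the arrow metalanguage `UΠ^χ_a` -/

/-- Well-typed combinators `b₁ ⇝ b₂` of `UΠ^χ_a`. The only primitive is `lift v`, for a `UΠ_a`
combinator `v : b₁ ↣ b₂ × b₃` with garbage of inhabited type `b₃`; all other combinators of the
language (`arr`, `>>>`, `***`, `+++`, `discard`, `measure`, ...) are abbreviations of terms of this
form. -/
inductive UPiChiA : Ty → Ty → Type
  | lift {b₁ b₂ b₃ : Ty} (v : UPiA b₁ (.prod b₂ b₃)) (h : b₃.Inhabited) : UPiChiA b₁ b₂

namespace UPiChiA

/-- The semantics of `UΠ^χ_a` combinators in `CPTP`, as linear maps on matrices: conjugation by the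
isometry `⟦v⟧ : ⟦b₁⟧ → ⟦b₂⟧ ⊗ ⟦b₃⟧` followed by the partial trace over the garbage `⟦b₃⟧`. -/
noncomputable def sem : {a b : Ty} → UPiChiA a b →
    (Matrix a.Basis a.Basis ℂ →ₗ[ℂ] Matrix b.Basis b.Basis ℂ)
  | _, _, .lift v _ => partialTraceRight.comp (conjMap v.sem)

end UPiChiA

/-! ### Permutation matrices, phases and block elimination -/

open Matrix

/-! Every channel is denoted exactly, so the approximation error is zero in any norm. Since all
phases are available, each unitary has an exact finite synthesis (`UPi.exists_sem_eq`): structural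
isomorphisms reduce to the space with basis `1 + (1 + ⋯ + 0)`, and a QR-style elimination, with
two-level rotations built from Hadamards and phases, peels off one column at a time.

Allocation then gives all isometries, by completing the columns to an orthonormal basis and using
the missing dimensions as heap. Hiding gives all channels by Stinespring dilation: complete
positivity makes the Choi matrix positive, a factorization `star C * C` supplies Kraus operators,
and trace preservation makes the dilation an isometry. -/

theorem basisBij_mulVec {α β : Type} [Fintype α] [DecidableEq α] [DecidableEq β] (e : α ≃ β)
    (v : α → ℂ) : basisBij e *ᵥ v = v ∘ e.symm := by
  ext y
  simp [basisBij, mulVec, dotProduct, ← Equiv.symm_apply_eq]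

theorem basisBij_symm {α β : Type} [DecidableEq α] [DecidableEq β] (e : α ≃ β) :
    basisBij e.symm = (basisBij e)ᴴ := by
  ext x y
  by_cases h : y = e x
  · simp [basisBij, h]
  · have : x ≠ e.symm y := fun h' => h (by simp [h'])
    simp [basisBij, h, this]

theorem basisBij_mul_conjTranspose {α β : Type} [Fintype α] [DecidableEq α] [DecidableEq β]
    (e : α ≃ β) : basisBij e * (basisBij e)ᴴ = 1 := by
  ext x y
  rw [Matrix.mul_apply, Matrix.one_apply, Finset.sum_eq_single (e.symm x)]
  · simp [basisBij, eq_comm]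
  · intro i _ hi
    have : x ≠ e i := fun h => hi (by simp [h])
    simp [basisBij, this]
  · simp

theorem Circle.exists_mul_eq_norm (x : ℂ) : ∃ φ : Circle, (φ : ℂ) * x = ‖x‖ := by
  refine ⟨(Circle.exp x.arg)⁻¹, ?_⟩
  have h : ((Circle.exp x.arg : Circle) : ℂ) ≠ 0 := Circle.coe_ne_zero _
  have hx := Complex.norm_mul_exp_arg_mul_I x
  rw [← Circle.coe_exp] at hx
  rw [Circle.coe_inv, inv_mul_eq_iff_eq_mul₀ h, mul_comm, hx]

/-- A matrix with orthonormal columns whose first column is a nonnegative multiple of the first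
basis vector is block diagonal. -/
theorem Matrix.exists_eq_fromBlocks_one {β : Type} [Fintype β] [DecidableEq β]
    (N : Matrix (Unit ⊕ β) (Unit ⊕ β) ℂ) (hN : Nᴴ * N = 1) (r : ℝ) (hr : 0 ≤ r)
    (hcol : ∀ i, N i (.inl ()) = Sum.elim (fun _ => (r : ℂ)) (fun _ => 0) i) :
    ∃ D : Matrix β β ℂ, Dᴴ * D = 1 ∧ N = fromBlocks 1 0 0 D := by
  have hA : N.toBlocks₁₁ = (r : ℂ) • 1 := by
    ext
    simpa [toBlocks₁₁] using hcol (.inl ())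
  have hC : N.toBlocks₂₁ = 0 := by
    ext i
    simpa [toBlocks₂₁] using hcol (.inr i)
  rw [← fromBlocks_toBlocks N, hA, hC, fromBlocks_conjTranspose, fromBlocks_multiply,
    ← fromBlocks_one, fromBlocks_inj] at hN
  -- `h₁` says `r ^ 2 = 1`, so `r = 1` by nonnegativity; `h₂` then kills the upper right block.
  obtain ⟨h₁, h₂, -, h₄⟩ := hN
  have hr1 : r = 1 := by
    have := congrFun (congrFun h₁ ()) ()
    simp only [conjTranspose_smul, conjTranspose_one, conjTranspose_zero, Matrix.zero_mul,
      add_zero, smul_mul_smul_comm, smul_apply, one_apply_eq, smul_eq_mul,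
      mul_one, Complex.star_def, Complex.conj_ofReal] at this
    norm_cast at this
    nlinarith
  subst hr1
  have hB : N.toBlocks₁₂ = 0 := by simpa using h₂
  refine ⟨N.toBlocks₂₂, by simpa [hB] using h₄, ?_⟩
  conv_lhs => rw [← fromBlocks_toBlocks N, hA, hB, hC]
  simp

/-! ### Dimensions and normal forms of types -/

namespace Ty

/-- The type `1 + (1 + ⋯ + (1 + 0))` with `n` summands. -/
def fin : ℕ → Ty
  | 0 => zero
  | n + 1 => sum one (fin n)

/-- The dimension of `⟦b⟧`. -/
def dim : Ty → ℕ
  | zero => 0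
  | one => 1
  | sum a b => a.dim + b.dim
  | prod a b => a.dim * b.dim

theorem card_basis : (b : Ty) → Fintype.card b.Basis = b.dim
  | zero => rfl
  | one => rfl
  | sum a b => (Fintype.card_sum (α := a.Basis) (β := b.Basis)).trans
      (congrArg₂ (· + ·) (card_basis a) (card_basis b))
  | prod a b => (Fintype.card_prod a.Basis b.Basis).trans
      (congrArg₂ (· * ·) (card_basis a) (card_basis b))

theorem dim_fin (n : ℕ) : (fin n).dim = n := by
  induction n with
  | zero => rfl
  | succ n ih => simp [fin, dim, ih, add_comm]

theorem inhabited_of_nonempty_basis : (b : Ty) → Nonempty b.Basis → b.Inhabited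
  | zero, ⟨x⟩ => x.elim
  | one, _ => .one
  | sum a _, ⟨.inl x⟩ => .sumLeft (inhabited_of_nonempty_basis a ⟨x⟩)
  | sum _ b, ⟨.inr x⟩ => .sumRight (inhabited_of_nonempty_basis b ⟨x⟩)
  | prod a b, ⟨x⟩ =>
    .prod (inhabited_of_nonempty_basis a ⟨x.1⟩) (inhabited_of_nonempty_basis b ⟨x.2⟩)

end Ty

/-! ### Inverses and unitarity -/

namespace UPi

/-- The inverse combinator. -/
noncomputable def inv : {a b : Ty} → UPi a b → UPi b a
  | _, _, .id => .id
  | _, _, .swapSum => .swapSum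
  | _, _, .unitSum => .unitiSum
  | _, _, .unitiSum => .unitSum
  | _, _, .assocSum => .associSum
  | _, _, .associSum => .assocSum
  | _, _, .swapProd => .swapProd
  | _, _, .unitProd => .unitiProd
  | _, _, .unitiProd => .unitProd
  | _, _, .assocProd => .associProd
  | _, _, .associProd => .assocProd
  | _, _, .distrib => .distribi
  | _, _, .distribi => .distrib
  | _, _, .distribo => .distriboi
  | _, _, .distriboi => .distribo
  | _, _, .phase φ => .phase φ⁻¹
  | _, _, .hadamard => .hadamard
  | _, _, .comp u v => .comp v.inv u.inv
  | _, _, .sum u v => .sum u.inv v.inv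
  | _, _, .prod u v => .prod u.inv v.inv

theorem sem_inv {a b : Ty} (u : UPi a b) : u.inv.sem = u.semᴴ := by
  induction u with
  | id => simp [inv, sem]
  | swapSum => exact basisBij_symm (Equiv.sumComm _ _)
  | unitSum => exact basisBij_symm _
  | unitiSum => exact basisBij_symm (Equiv.sumEmpty _ _).symm
  | assocSum => exact basisBij_symm _
  | associSum => exact basisBij_symm (Equiv.sumAssoc _ _ _).symm
  | swapProd => exact basisBij_symm (Equiv.prodComm _ _)
  | unitProd => exact basisBij_symm _
  | unitiProd => exact basisBij_symm (Equiv.prodPUnit _).symm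
  | assocProd => exact basisBij_symm _
  | associProd => exact basisBij_symm (Equiv.prodAssoc _ _ _).symm
  | distrib => exact basisBij_symm _
  | distribi => exact basisBij_symm (Equiv.prodSumDistrib _ _ _).symm
  | distribo => exact basisBij_symm _
  | distriboi => exact basisBij_symm (Equiv.prodEmpty _).symm
  | phase φ =>
    ext
    exact Circle.coe_inv_eq_conj φ
  | hadamard =>
    ext i j
    rcases i with i | i <;> rcases j with j | j <;> simp [inv, sem]
  | comp u v ihu ihv => simp [inv, sem, ihu, ihv]
  | sum u v ihu ihv => simp [inv, sem, ihu, ihv, fromBlocks_conjTranspose]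
  | prod u v ihu ihv =>
    simp only [inv, sem, ihu, ihv]
    exact (conjTranspose_kronecker _ _).symm

theorem sem_mul_conjTranspose {a b : Ty} (u : UPi a b) : u.sem * u.semᴴ = 1 := by
  induction u with
  | id => simp [sem]
  | phase φ =>
    ext
    simp [sem, Matrix.mul_apply, Complex.mul_conj]
  | hadamard =>
    have h : (((√2 : ℝ) : ℂ))⁻¹ * ((√2 : ℝ) : ℂ)⁻¹ = 2⁻¹ := by
      rw [← mul_inv, ← Complex.ofReal_mul, Real.mul_self_sqrt (by norm_num)]
      norm_num
    ext i j
    rcases i with i | i <;> rcases j with j | j <;>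
      simp [sem, Matrix.mul_apply, h] <;> norm_num
  | comp u v ihu ihv =>
    simp only [sem, conjTranspose_mul]
    rw [Matrix.mul_assoc, ← Matrix.mul_assoc u.sem, ihu, Matrix.one_mul, ihv]
  | sum u v ihu ihv =>
    simp only [sem, fromBlocks_conjTranspose, fromBlocks_multiply, ihu, ihv]
    simp
  | prod u v ihu ihv =>
    simp only [sem]
    erw [conjTranspose_kronecker, ← mul_kronecker_mul, ihu, ihv, one_kronecker_one]
  | _ => exact basisBij_mul_conjTranspose _

theorem sem_conjTranspose_mul {a b : Ty} (u : UPi a b) : u.semᴴ * u.sem = 1 := by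
  have := u.inv.sem_mul_conjTranspose
  rwa [sem_inv, conjTranspose_conjTranspose] at this

/-! ### Reduction to normal form -/

theorem nonempty_fin_sum (m n : ℕ) : Nonempty (UPi (.sum (.fin m) (.fin n)) (.fin (m + n))) := by
  induction m with
  | zero => exact ⟨by rw [Nat.zero_add]; exact .comp .swapSum .unitSum⟩
  | succ m ih =>
    obtain ⟨u⟩ := ih
    exact ⟨by rw [Nat.succ_add]; exact .comp .assocSum (.sum .id u)⟩

theorem nonempty_fin_prod (m n : ℕ) : Nonempty (UPi (.prod (.fin m) (.fin n)) (.fin (m * n))) := by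
  induction n with
  | zero => exact ⟨.distribo⟩
  | succ n ih =>
    obtain ⟨u⟩ := ih
    obtain ⟨v⟩ := nonempty_fin_sum m (m * n)
    exact ⟨by rw [Nat.mul_succ, Nat.add_comm (m * n)]; exact .comp .distrib (.comp (.sum .unitProd u) v)⟩

/-- Any combinator will do here: its unitary is cancelled by conjugation in `exists_sem_eq`, so its
matrix need not be known. -/
theorem nonempty_fin_dim (b : Ty) : Nonempty (UPi b (.fin b.dim)) := by
  induction b with
  | zero => exact ⟨.id⟩
  | one => exact ⟨.unitiSum⟩
  | sum a b iha ihb =>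
    obtain ⟨u⟩ := iha
    obtain ⟨v⟩ := ihb
    obtain ⟨w⟩ := nonempty_fin_sum a.dim b.dim
    exact ⟨.comp (.sum u v) w⟩
  | prod a b iha ihb =>
    obtain ⟨u⟩ := iha
    obtain ⟨v⟩ := ihb
    obtain ⟨w⟩ := nonempty_fin_prod a.dim b.dim
    exact ⟨.comp (.prod u v) w⟩

/-! ### Exact synthesis of unitaries -/

theorem sem_comp_mulVec {a b c : Ty} (u : UPi a b) (v : UPi b c) (x : a.Basis → ℂ) :
    (comp u v).sem *ᵥ x = v.sem *ᵥ (u.sem *ᵥ x) :=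
  (mulVec_mulVec _ _ _).symm

theorem sem_diag_mulVec (φ ψ : Circle) (x y : ℂ) :
    (sum (phase φ) (phase ψ)).sem *ᵥ (Sum.elim (fun _ => x) fun _ => y) =
      Sum.elim (fun _ => φ * x) fun _ => ψ * y := by
  simp only [sem]
  erw [fromBlocks_mulVec]
  ext i
  rcases i with i | i <;> simp [mulVec, dotProduct]

theorem sem_hadamard_mulVec (x y : ℂ) :
    hadamard.sem *ᵥ (Sum.elim (fun _ => x) fun _ => y) =
      Sum.elim (fun _ => ((√2 : ℝ) : ℂ)⁻¹ * (x + y)) fun _ => ((√2 : ℝ) : ℂ)⁻¹ * (x - y) := by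
  simp only [sem]
  rw [smul_mulVec]
  erw [fromBlocks_mulVec]
  ext i
  rcases i with i | i <;> simp [mulVec, dotProduct, sub_eq_add_neg]

/-- Phases turn `(x, y)` into `(‖x‖, i‖y‖)`. A Hadamard makes the entries complex conjugate, hence
of equal modulus; opposite phases `ω`, `ω⁻¹` make them equal, and a second Hadamard moves everything
into the first entry. -/
theorem exists_qubit_rotation (x y : ℂ) :
    ∃ (u : UPi (.sum .one .one) (.sum .one .one)) (r : ℝ), 0 ≤ r ∧
      u.sem *ᵥ (Sum.elim (fun _ => x) fun _ => y) = Sum.elim (fun _ => (r : ℂ)) fun _ => 0 := by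
  obtain ⟨φ, hφ⟩ := Circle.exists_mul_eq_norm x
  obtain ⟨ψ, hψ⟩ := Circle.exists_mul_eq_norm y
  let ι : Circle := ⟨Complex.I, by simp [Submonoid.unitSphere]⟩
  obtain ⟨ω, hω⟩ := Circle.exists_mul_eq_norm (‖x‖ + Complex.I * ‖y‖)
  set r := ‖(‖x‖ + Complex.I * ‖y‖ : ℂ)‖
  have hω' : ((ω⁻¹ : Circle) : ℂ) * (‖x‖ - Complex.I * ‖y‖) = r := by
    have := congrArg (starRingEnd ℂ) hω
    rw [Circle.coe_inv_eq_conj]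
    simpa [sub_eq_add_neg] using this
  have hs : ((√2 : ℝ) : ℂ)⁻¹ * ((√2 : ℝ) : ℂ)⁻¹ = 2⁻¹ := by
    rw [← mul_inv, ← Complex.ofReal_mul, Real.mul_self_sqrt (by norm_num)]
    norm_num
  refine ⟨.comp (.sum (.phase φ) (.phase (ι * ψ))) (.comp .hadamard
    (.comp (.sum (.phase ω) (.phase ω⁻¹)) .hadamard)), r, norm_nonneg _, ?_⟩
  have hι : ((ι * ψ : Circle) : ℂ) * y = Complex.I * ‖y‖ := by
    rw [Circle.coe_mul, mul_assoc, hψ]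
  rw [sem_comp_mulVec, sem_comp_mulVec, sem_comp_mulVec, sem_diag_mulVec,
    hφ, hι, sem_hadamard_mulVec, sem_diag_mulVec, mul_left_comm, hω, mul_left_comm, hω',
    sem_hadamard_mulVec, sub_self, mul_zero, ← two_mul, mul_left_comm, ← mul_assoc _ _ (r : ℂ), hs]
  simp

theorem sem_sum_mulVec {a b c d : Ty} (u : UPi a c) (v : UPi b d) (x : a.Basis → ℂ)
    (y : b.Basis → ℂ) :
    (sum u v).sem *ᵥ Sum.elim x y = Sum.elim (u.sem *ᵥ x) (v.sem *ᵥ y) := by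
  simp only [sem]
  erw [fromBlocks_mulVec]
  simp

/-- The tail is first rotated onto its leading coordinate; reassociating then pairs that coordinate
with the head as a qubit, where one two-level rotation finishes. -/
theorem exists_rotation (n : ℕ) (v : (Ty.sum .one (.fin n)).Basis → ℂ) :
    ∃ (u : UPi (.sum .one (.fin n)) (.sum .one (.fin n))) (r : ℝ), 0 ≤ r ∧
      u.sem *ᵥ v = Sum.elim (fun _ => (r : ℂ)) fun _ => 0 := by
  induction n with
  | zero =>
    obtain ⟨φ, hφ⟩ := Circle.exists_mul_eq_norm (v (.inl ()))
    refine ⟨.sum (.phase φ) .id, ‖v (.inl ())‖, norm_nonneg _, ?_⟩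
    have hv : v = Sum.elim (fun _ => v (.inl ())) (fun _ => 0) := by
      ext i
      rcases i with i | i
      · rfl
      · exact Empty.elim i
    conv_lhs => rw [hv]
    erw [sem_sum_mulVec]
    ext i
    rcases i with i | i
    · simpa [sem, mulVec, dotProduct] using hφ
    · exact Empty.elim i
  | succ n ih =>
    -- Unfolds `fin (n + 1)` in the types, so that the constructors for `1 + (1 + fin n)` apply.
    revert v
    change ∀ v : (Ty.sum .one (.sum .one (.fin n))).Basis → ℂ,
      ∃ (u : UPi (.sum .one (.sum .one (.fin n))) (.sum .one (.sum .one (.fin n)))) (r : ℝ),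
        0 ≤ r ∧ u.sem *ᵥ v = Sum.elim (fun _ => (r : ℂ)) fun _ => 0
    intro v
    obtain ⟨u, s, -, hu⟩ := ih (v ∘ Sum.inr)
    obtain ⟨w, r, hr, hw⟩ := exists_qubit_rotation (v (.inl ())) s
    refine ⟨.comp (.sum .id u) (.comp .associSum (.comp (.sum w .id) .assocSum)), r, hr, ?_⟩
    have hv : v = Sum.elim (fun _ => v (.inl ())) (v ∘ Sum.inr) := by
      ext i
      rcases i with i | i <;> rfl
    have h₁ : (sum (id (b := .one)) u).sem *ᵥ v =
        Sum.elim (fun _ => v (.inl ())) (Sum.elim (fun _ => (s : ℂ)) fun _ => 0) := by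
      conv_lhs => rw [hv]
      refine (sem_sum_mulVec id u _ _).trans ?_
      rw [hu]
      exact congrArg (Sum.elim · _) (one_mulVec _)
    have h₂ : (associSum (a := .one) (b := .one) (c := .fin n)).sem *ᵥ
        Sum.elim (fun _ => v (.inl ())) (Sum.elim (fun _ => (s : ℂ)) fun _ => 0) =
        Sum.elim (Sum.elim (fun _ => v (.inl ())) fun _ => (s : ℂ)) fun _ => 0 := by
      refine (basisBij_mulVec _ _).trans ?_
      ext i
      rcases i with (i | i) | i <;> rfl
    have h₃ : (sum w (id (b := .fin n))).sem *ᵥ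
        Sum.elim (Sum.elim (fun _ => v (.inl ())) fun _ => (s : ℂ)) (fun _ => 0) =
        Sum.elim (Sum.elim (fun _ => (r : ℂ)) fun _ => 0) fun _ => 0 := by
      refine (sem_sum_mulVec w id _ _).trans ?_
      rw [hw]
      exact congrArg (Sum.elim _ ·) (one_mulVec _)
    rw [sem_comp_mulVec, sem_comp_mulVec, sem_comp_mulVec, h₁, h₂, h₃]
    refine (basisBij_mulVec _ _).trans ?_
    ext i
    rcases i with i | i | i <;> rfl

theorem exists_sem_eq_of_fin (n : ℕ) (M : Matrix (Ty.fin n).Basis (Ty.fin n).Basis ℂ)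
    (h : Mᴴ * M = 1) : ∃ u : UPi (.fin n) (.fin n), u.sem = M := by
  induction n with
  | zero => exact ⟨.id, by ext i; exact Empty.elim i⟩
  | succ n ih =>
    revert M
    change ∀ M : Matrix (Ty.sum .one (.fin n)).Basis (Ty.sum .one (.fin n)).Basis ℂ,
      Mᴴ * M = 1 → ∃ u : UPi (.sum .one (.fin n)) (.sum .one (.fin n)), u.sem = M
    intro M h
    -- Clearing the first column makes `u.sem * M` equal to `1 ⊕ D` with `D` unitary; the induction
    -- hypothesis synthesizes `D`.
    obtain ⟨u, r, hr, hu⟩ := exists_rotation n (M.col (.inl ()))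
    have hN : (u.sem * M)ᴴ * (u.sem * M) = 1 := by
      rw [conjTranspose_mul, Matrix.mul_assoc, ← Matrix.mul_assoc _ u.sem,
        sem_conjTranspose_mul, Matrix.one_mul, h]
    obtain ⟨D, hD, hND⟩ := exists_eq_fromBlocks_one (β := (Ty.fin n).Basis) (u.sem * M)
      hN r hr (fun i => congrFun hu i)
    obtain ⟨w, hw⟩ := ih D hD
    refine ⟨.comp (.sum .id w) u.inv, ?_⟩
    have hs : (sum (id (b := .one)) w).sem = u.sem * M := by
      rw [hND, ← hw]
      rfl
    change u.inv.sem * (sum (id (b := .one)) w).sem = M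
    rw [hs, sem_inv, ← Matrix.mul_assoc, sem_conjTranspose_mul, Matrix.one_mul]

/-- Every unitary matrix is the denotation of a combinator. -/
theorem exists_sem_eq {a b : Ty} (hab : a.dim = b.dim) (M : Matrix b.Basis a.Basis ℂ)
    (h : Mᴴ * M = 1) : ∃ u : UPi a b, u.sem = M := by
  obtain ⟨v⟩ := nonempty_fin_dim a
  obtain ⟨w⟩ := nonempty_fin_dim b
  rw [← hab] at w
  obtain ⟨u, hu⟩ := exists_sem_eq_of_fin a.dim (w.sem * M * v.semᴴ) (by
    simp only [conjTranspose_mul, conjTranspose_conjTranspose]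
    rw [show v.sem * (Mᴴ * w.semᴴ) * (w.sem * M * v.semᴴ) =
      v.sem * (Mᴴ * ((w.semᴴ * w.sem) * M)) * v.semᴴ by simp only [Matrix.mul_assoc],
      sem_conjTranspose_mul, Matrix.one_mul, h, Matrix.mul_one, sem_mul_conjTranspose])
  refine ⟨.comp v (.comp u w.inv), ?_⟩
  change w.inv.sem * u.sem * v.sem = M
  rw [hu, sem_inv, show w.semᴴ * (w.sem * M * v.semᴴ) * v.sem =
      (w.semᴴ * w.sem) * M * (v.semᴴ * v.sem) by simp only [Matrix.mul_assoc],
    sem_conjTranspose_mul, sem_conjTranspose_mul, Matrix.one_mul, Matrix.mul_one]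

end UPi

/-! ### Unitary extension and Stinespring dilation -/

/-- A matrix with orthonormal columns is the left block of a unitary matrix. -/
theorem Matrix.exists_unitary_extension {α γ κ : Type} [Fintype α] [DecidableEq α] [Fintype γ]
    [DecidableEq γ] [Fintype κ] [DecidableEq κ] (hcard : Fintype.card (α ⊕ γ) = Fintype.card κ)
    (V : Matrix κ α ℂ) (hV : Vᴴ * V = 1) :
    ∃ U : Matrix κ (α ⊕ γ) ℂ, Uᴴ * U = 1 ∧ U.submatrix id Sum.inl = V := by
  let v : α ⊕ γ → EuclideanSpace ℂ κ := Sum.elim (fun a => WithLp.toLp 2 fun k => V k a) 0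
  have hinner (x y : EuclideanSpace ℂ κ) : inner ℂ x y = ∑ k, star (x k) * y k := by
    simp [PiLp.inner_apply, mul_comm]
  have hv : Orthonormal ℂ ((Set.range Sum.inl).domRestrict v) := by
    rw [orthonormal_iff_ite]
    rintro ⟨_, a, rfl⟩ ⟨_, a', rfl⟩
    have := congrFun (congrFun hV a) a'
    rw [hinner]
    simpa [v, Matrix.mul_apply, Matrix.one_apply, Subtype.ext_iff] using this
  obtain ⟨b, hb⟩ := hv.exists_orthonormalBasis_extension_of_card_eq (by simpa using hcard.symm)
  refine ⟨Matrix.of fun k i => b i k, ?_, ?_⟩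
  · ext i j
    have := orthonormal_iff_ite.mp b.orthonormal i j
    rw [hinner] at this
    simpa [Matrix.mul_apply, Matrix.one_apply] using this
  · ext k a
    simp [hb (Sum.inl a) ⟨a, rfl⟩, v]

theorem NonUnitalCStarAlgebra.exists_eq_star_mul_self {A : Type*} [NonUnitalCStarAlgebra A]
    [PartialOrder A] [StarOrderedRing A] {a : A} (ha : 0 ≤ a) : ∃ b, a = star b * b :=
  CStarAlgebra.nonneg_iff_eq_star_mul_self.mp ha

/-- This is the Kraus form on matrix units; these span, so it identifies the dilated map with the
channel. -/
theorem partialTraceRight_conjMap_single {α β γ : Type} [Fintype α] [DecidableEq α] [Fintype γ]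
    (V : Matrix (β × γ) α ℂ) (i j : α) (a b : β) :
    partialTraceRight (conjMap V (Matrix.single i j 1)) a b =
      ∑ g, V (a, g) i * star (V (b, g) j) := by
  refine Finset.sum_congr rfl fun g _ => ?_
  simp [conjMap, Matrix.mul_apply, Matrix.single_apply, ite_and]

open scoped Matrix.Norms.L2Operator MatrixOrder CStarAlgebra in
/-- The Stinespring dilation of a quantum channel. -/
theorem QuantumChannel.exists_stinespring {α β : Type} [Fintype α] [DecidableEq α] [Fintype β]
    [DecidableEq β] (Λ : QuantumChannel α β) :
    ∃ V : Matrix (β × (α × β)) α ℂ, Vᴴ * V = 1 ∧ Λ.map = partialTraceRight.comp (conjMap V) := by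
  -- The unnormalized maximally entangled state; its image under the entrywise action of `Λ` is the
  -- Choi matrix.
  let M : CStarMatrix α α (Matrix α α ℂ) :=
    CStarMatrix.ofMatrix (Matrix.of fun i j => Matrix.single i j 1)
  have hM : 0 ≤ M := by
    rcases isEmpty_or_nonempty α with hα | ⟨⟨o⟩⟩
    · exact (Subsingleton.elim _ _).le
    -- Only row `o` of `B` is nonzero, and `E_io * E_oj = E_ij` gives `M = star B * B`.
    · let B : CStarMatrix α α (Matrix α α ℂ) :=
        CStarMatrix.ofMatrix (Matrix.of fun i j => if i = o then Matrix.single o j 1 else 0)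
      have : M = star B * B := by
        ext i j : 2
        simp [M, B, CStarMatrix.mul_apply, CStarMatrix.star_apply,
          star_eq_conjTranspose]
      rw [this]
      exact star_mul_self_nonneg _
  obtain ⟨C, hC⟩ := NonUnitalCStarAlgebra.exists_eq_star_mul_self
    (Λ.toCompletelyPositiveMap.map_cstarMatrix_nonneg M hM)
  have hΛ (i j : α) (a b : β) : Λ.map (Matrix.single i j 1) a b =
      ∑ g : α × β, star (C g.1 i g.2 a) * C g.1 j g.2 b := by
    have : Λ.map (Matrix.single i j 1) a b = (star C * C) i j a b :=
      congrFun (congrFun (congrFun (congrFun hC i) j) a) b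
    rw [Fintype.sum_prod_type]
    simpa [CStarMatrix.mul_apply, CStarMatrix.star_apply, M, star_eq_conjTranspose,
      Matrix.sum_apply, Matrix.mul_apply] using this
  -- The environment `α × β` indexes the rows of `C`; the conjugate matches the order of factors in
  -- `hΛ`.
  refine ⟨Matrix.of fun x i => star (C x.2.1 i x.2.2 x.1), ?_, ?_⟩
  -- The `(j, i)` entry of `Vᴴ * V` is the trace of `Λ (E_ij)`, which is `δ_ij` by trace
  -- preservation.
  · ext j i
    have := Λ.trace_map (Matrix.single i j 1)
    change (Λ.map (Matrix.single i j 1)).trace = _ at this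
    have htr : (Λ.map (Matrix.single i j 1)).trace =
        ∑ b, ∑ g : α × β, star (C g.1 i g.2 b) * C g.1 j g.2 b :=
      Finset.sum_congr rfl fun b _ => hΛ i j b b
    rw [htr] at this
    rw [Matrix.mul_apply, Fintype.sum_prod_type]
    simp only [Matrix.one_apply, conjTranspose_apply, of_apply, star_star]
    simp only [mul_comm] at this ⊢
    rw [this]
    rcases eq_or_ne j i with rfl | h
    · simp [trace_single_eq_same]
    · simp [trace_single_eq_of_ne _ _ _ h.symm, h]
  · refine Matrix.ext_linearMap ℂ fun i j => LinearMap.ext_ring ?_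
    ext a b
    change Λ.map (Matrix.single i j 1) a b =
      partialTraceRight (conjMap _ (Matrix.single i j 1)) a b
    rw [hΛ, partialTraceRight_conjMap_single]
    simp

/-! ### Norms of the zero map -/

open scoped Matrix.Norms.L2Operator in
theorem spectralOpNorm_zero {α β : Type} [Fintype α] [DecidableEq α] [Fintype β]
    [DecidableEq β] : spectralOpNorm (0 : Matrix α α ℂ →ₗ[ℂ] Matrix β β ℂ) = 0 :=
  (congrArg norm (map_zero LinearMap.toContinuousLinearMap)).trans norm_zero

theorem traceNorm_zero {α : Type} [Fintype α] [DecidableEq α] :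
    traceNorm (0 : Matrix α α ℂ) = 0 := by
  simp [traceNorm]

theorem traceOpNorm_zero {α β : Type} [Fintype α] [DecidableEq α] [Fintype β]
    [DecidableEq β] : traceOpNorm (0 : Matrix α α ℂ →ₗ[ℂ] Matrix β β ℂ) = 0 := by
  simp [traceOpNorm, traceNorm_zero]

theorem ampliation_zero {α β : Type} (k : ℕ) :
    ampliation (0 : Matrix α α ℂ →ₗ[ℂ] Matrix β β ℂ) k = 0 := rfl

theorem diamondNorm_zero {α β : Type} [Fintype α] [DecidableEq α] [Fintype β]
    [DecidableEq β] : diamondNorm (0 : Matrix α α ℂ →ₗ[ℂ] Matrix β β ℂ) = 0 := by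
  simp [diamondNorm, ampliation_zero, traceOpNorm_zero]

/-! ### Synthesis of isometries and channels -/

/-- A diagonal matrix unit has trace `1`, while every matrix over an empty index type has trace `0`.
-/
theorem QuantumChannel.nonempty {α β : Type} [Fintype α] [DecidableEq α] [Fintype β]
    [DecidableEq β] (Λ : QuantumChannel α β) [hα : Nonempty α] : Nonempty β := by
  obtain ⟨a⟩ := hα
  by_contra hβ
  rw [not_nonempty_iff] at hβ
  have := Λ.trace_map (Matrix.single a a 1)
  simp [Matrix.trace] at this

/-- Every isometry is the denotation of a combinator with allocation. -/
theorem UPiA.exists_sem_eq {a b : Ty} (hab : a.dim ≤ b.dim) (V : Matrix b.Basis a.Basis ℂ)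
    (hV : V.conjTranspose * V = 1) : ∃ v : UPiA a b, v.sem = V := by
  -- The heap fills exactly the missing dimensions; `hab` keeps the subtraction from truncating.
  let c := Ty.fin (b.dim - a.dim)
  have hdim : (Ty.sum a c).dim = b.dim := by
    simp only [Ty.dim, c, Ty.dim_fin]
    omega
  obtain ⟨U, hU, hUV⟩ := Matrix.exists_unitary_extension (γ := c.Basis)
    (((Ty.sum a c).card_basis.trans hdim).trans b.card_basis.symm) V hV
  obtain ⟨u, hu⟩ := UPi.exists_sem_eq hdim U hU
  exact ⟨.lift u, by rw [UPiA.sem, hu]; exact hUV⟩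

/-- Every quantum channel is the denotation of a combinator with allocation and hiding. -/
theorem UPiChiA.exists_sem_eq {a b : Ty} (Λ : QuantumChannel a.Basis b.Basis) :
    ∃ c : UPiChiA a b, c.sem = Λ.map := by
  -- For zero-dimensional input the Stinespring garbage `a × b` is uninhabited, so `one` serves
  -- instead and both maps vanish trivially.
  rcases isEmpty_or_nonempty a.Basis with ha | ha
  · have hdim : a.dim = 0 := by rw [← a.card_basis, Fintype.card_eq_zero_iff]; exact ha
    obtain ⟨v, -⟩ := UPiA.exists_sem_eq (a := a) (b := .prod b .one) (by simp [hdim]) 0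
      (Subsingleton.elim _ _)
    exact ⟨.lift v .one, LinearMap.ext fun X => by rw [Subsingleton.elim X 0, map_zero, map_zero]⟩
  -- Nonemptiness of `b` makes the garbage `a × b` inhabited and gives the dimension bound `a.dim ≤
  -- b.dim * (a.dim * b.dim)`.
  · have hb : Nonempty b.Basis := Λ.nonempty
    obtain ⟨V, hV, hΛ⟩ := Λ.exists_stinespring
    have hdim : a.dim ≤ (Ty.prod b (.prod a b)).dim := by
      have : 0 < b.dim := b.card_basis ▸ Fintype.card_pos
      simp only [Ty.dim]
      nlinarith [Nat.mul_le_mul this this, Nat.zero_le a.dim]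
    obtain ⟨v, hv⟩ := UPiA.exists_sem_eq (b := .prod b (.prod a b)) hdim V hV
    refine ⟨.lift v (.prod (a.inhabited_of_nonempty_basis ha) (b.inhabited_of_nonempty_basis hb)),
      ?_⟩
    rw [UPiChiA.sem, hv, hΛ]

theorem theorem3 (b₁ b₂ : Ty) (Λ : QuantumChannel b₁.Basis b₂.Basis) (δ : ℝ) (hδ : 0 < δ) :
    ∃ c : UPiChiA b₁ b₂,
      spectralOpNorm (Λ.map - c.sem) < δ ∧
      traceOpNorm (Λ.map - c.sem) < ENNReal.ofReal δ ∧
      diamondNorm (Λ.map - c.sem) < ENNReal.ofReal δ := by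
  obtain ⟨c, hc⟩ := UPiChiA.exists_sem_eq Λ
  refine ⟨c, ?_⟩
  -- The synthesis is exact, so one `c` serves for all three norms and every `δ`.
  rw [hc, sub_self, spectralOpNorm_zero, traceOpNorm_zero, diamondNorm_zero]
  exact ⟨hδ, ENNReal.ofReal_pos.mpr hδ, ENNReal.ofReal_pos.mpr hδ⟩
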